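/- Fix $\theta>0$. For $n\in\mathbb N=\{1,2,\dots\}$ let $K_n(\theta)$ have the Ewens distribution, $$\mathbb P\{K_n(\theta)=k\}=\frac{\theta^k}{\theta(\theta+1)\cdots(\theta+n-1)}\left[{n\atop k}\right],\qquad k=1,\dots,n,$$ where $\left[{n\atop k}\right]$ are the unsigned Stirling numbers of the first kind. Let $u_n(\theta)$ be its mode, i.e. the least $k\in\{1,\dots,n\}$ maximizing $\mathbb P\{K_n(\theta)=k\}$, and put $$u_n^*(\theta)=\theta\log n-\frac{\theta\,\Gamma'(\theta)}{\Gamma(\theta)}-\frac12 .$$ Write $\{x\}=x-\lfloor x\rfloor$, and let $\operatorname{nint}(x)$ be the integer nearest to $x$, with $\operatorname{nint}(x)=\lfloor x\rfloor$ if $\{x\}=\frac12$. Then: (i) There is a constant $C_0>0$ (depending on $\theta$) such that for all $n\ge 2$ with $\left|\{u_n^*(\theta)\}-\frac12\right|>\frac{C_0}{\log n}$ one has $$u_n(\theta)=\operatorname{nint}(u_n^*(\theta))=\left\lfloor\theta\log n-\frac{\theta\,\Gamma'(\theta)}{\Gamma(\theta)}\right\rfloor .$$ (ii) There are arbitrarily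 long intervals of consecutive $n\in\mathbb N$ on which $u_n(\theta)=\lceil u_n^*(\theta)\rceil$, and arbitrarily long intervals of consecutive $n\in\mathbb N$ on which $u_n(\theta)=\lfloor u_n^*(\theta)\rfloor$. (iii) The set $A$ of $n\in\mathbb N$ with $u_n(\theta)=\operatorname{nint}(u_n^*(\theta))$ has asymptotic density one, i.e. $\lim_{n\to\infty}\frac1n\#(A\cap\{1,\dots,n\})=1$. The same holds for the set of $n\in\mathbb N$ with $u_n(\theta)=\left\lfloor\theta\log n-\frac{\theta\,\Gamma'(\theta)}{\Gamma(\theta)}\right\rfloor$. (iv) There are infinitely many $n\in\mathbb N$ with $u_n(\theta)\ne\operatorname{nint}(u_n^*(\theta))$, and infinitely many $n\in\mathbb N$ with $u_n(\theta)\ne\left\lfloor\theta\log n-\frac{\theta\,\Gamma'(\theta)}{\Gamma(\theta)}\right\rfloor$. -/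

import Mathlib

open Filter Topology

namespace Ewens

/-- Probability mass function of the Ewens distribution with parameter `θ`:
`P{K_n(θ) = k} = θ^k / θ^{(n)} * [n, k]`, where `θ^{(n)} = θ (θ+1) ⋯ (θ+n-1)` is the rising
factorial and `[n, k]` is the unsigned Stirling number of the first kind. -/
noncomputable def prob (θ : ℝ) (n k : ℕ) : ℝ :=
  θ ^ k / (ascPochhammer ℝ n).eval θ * (Nat.stirlingFirst n k : ℝ)

/-- `k` is a mode of the Ewens distribution: it maximizes the mass function on `{1, …, n}`. -/
def IsMode (θ : ℝ) (n k : ℕ) : Prop :=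
  k ∈ Set.Icc 1 n ∧ ∀ j ∈ Set.Icc 1 n, prob θ n j ≤ prob θ n k

/-- The least mode `u_n(θ)` (for `n ≥ 1`). -/
noncomputable def mode (θ : ℝ) (n : ℕ) : ℕ :=
  sInf {k | IsMode θ n k}

/-- `u_n^*(θ) = θ log n - θ Γ'(θ) / Γ(θ) - 1/2`. -/
noncomputable def modeApprox (θ : ℝ) (n : ℕ) : ℝ :=
  θ * Real.log n - θ * deriv Real.Gamma θ / Real.Gamma θ - 1 / 2

/-- The integer nearest to `x`; when `x` is a half-integer, the lower of the two candidates. -/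
noncomputable def nint (x : ℝ) : ℤ :=
  if Int.fract x ≤ 1 / 2 then ⌊x⌋ else ⌈x⌉

/-- The set `A ⊆ {1, 2, …}` has asymptotic density `α`. -/
def HasAsymptoticDensity (A : Set ℕ) (α : ℝ) : Prop :=
  Tendsto (fun n : ℕ => ((A ∩ Set.Icc 1 n).ncard : ℝ) / n) atTop (𝓝 α)

/-- The Stirling numbers are the coefficients of the rising factorial. -/
theorem ascPochhammer_eval_eq_sum (n : ℕ) (x : ℝ) :
    (ascPochhammer ℝ n).eval x =
      ∑ k ∈ Finset.range (n + 1), (Nat.stirlingFirst n k : ℝ) * x ^ k := by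
  induction n with
  | zero => simp
  | succ n ih =>
    rw [ascPochhammer_succ_eval, ih, Finset.sum_range_succ' _ (n + 1)]
    simp only [Nat.stirlingFirst_succ_succ, Nat.stirlingFirst_succ_zero]
    push_cast
    simp only [add_mul, Finset.sum_add_distrib, zero_mul, add_zero]
    have h := Finset.sum_range_succ' (fun k => (n : ℝ) * (Nat.stirlingFirst n k : ℝ) * x ^ k)
      (n + 1)
    rw [Finset.sum_range_succ, Nat.stirlingFirst_eq_zero_of_lt (Nat.lt_succ_self n)] at h
    have h0 : (n : ℝ) * (Nat.stirlingFirst n 0 : ℝ) = 0 := by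
      cases n <;> simp [Nat.stirlingFirst_succ_zero]
    rw [h0] at h
    simp only [Nat.cast_zero, mul_zero, zero_mul, add_zero] at h
    rw [← h, mul_add, Finset.sum_mul, Finset.sum_mul, add_comm]
    congr 1 <;> refine Finset.sum_congr rfl fun k _ => by ring

/-- For `n ≥ 1` the mode is well defined: it is the least element of the set of modes. -/
theorem mode_isLeast (θ : ℝ) {n : ℕ} (hn : 1 ≤ n) : IsLeast {k | IsMode θ n k} (mode θ n) := by
  have hne : {k | IsMode θ n k}.Nonempty := by
    obtain ⟨k, hk, hmax⟩ := (Finset.Icc 1 n).exists_max_image (prob θ n) ⟨1, by simp [hn]⟩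
    exact ⟨k, by simpa using hk, fun j hj => hmax j (by simpa using hj)⟩
  exact ⟨Nat.sInf_mem hne, fun k hk => Nat.sInf_le hk⟩

/-- `nint x` is an integer closest to `x`. -/
theorem abs_sub_nint_le (x : ℝ) (k : ℤ) : |x - nint x| ≤ |x - k| := by
  have h1 := Int.floor_le x
  have h2 := Int.lt_floor_add_one x
  have h3 := Int.le_ceil x
  have h4 : (⌈x⌉ : ℝ) ≤ ⌊x⌋ + 1 := by exact_mod_cast Int.ceil_le_floor_add_one x
  have hf : Int.fract x = x - ⌊x⌋ := rfl
  have hk : (k : ℝ) ≤ ⌊x⌋ ∨ (⌊x⌋ : ℝ) + 1 ≤ k := by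
    rcases le_or_gt k ⌊x⌋ with h | h
    · exact Or.inl (by exact_mod_cast h)
    · exact Or.inr (by exact_mod_cast h)
  unfold nint
  split_ifs with h
  · rw [abs_of_nonneg (by linarith)]
    rcases hk with hk | hk
    · exact le_trans (by linarith) (le_abs_self _)
    · exact le_trans (by linarith) (neg_le_abs _)
  · rw [abs_of_nonpos (by linarith)]
    rcases hk with hk | hk
    · exact le_trans (by linarith) (le_abs_self _)
    · exact le_trans (by linarith) (neg_le_abs _)

end Ewens

namespace Ewens

/-! `K_n - 1` is a sum of independent Bernoulli variables with odds `w j = θ / j`, `1 ≤ j < n`, so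
up to a constant factor its mass at `k` is the elementary symmetric function `e_k` of these odds.
Write `e_k^(j)` for the function with `w j` omitted and `μ = ∑ w j / (1 + w j)` for the mean. The
identity of `succ_mul_symm_eq_mean`, namely (k+2) e_{k+2} = μ e_{k+1} + ∑ w_j²/(1+w_j) (e_{k+1}^(j)
- e_k^(j)), compares consecutive ratios with those of the Poisson law of mean `μ`. Since `∑ w j ^ 2`
is bounded while `∑ w j` grows like `θ log n`, the differences near the mean are `O(1 / log n)`
relative to `e_{k+1}`. Hence the masses rise up to `⌊μ⌋` and do not rise afterwards, unless `μ` is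
within `O(1 / log n)` of an integer (`symm_unimodal`).

The mean of `K_n` is `θ (ψ(θ + n) - ψ(θ)) = θ log n - θ ψ(θ) + O(1 / n)`, so the mode is the floor
of `approxMean` outside such windows; this floor is the nearest integer to `modeApprox` except at
ties. As `approxMean` is logarithmic in `n`, its increments tend to zero, which gives the long
intervals, and the `n` close to an integer value form short multiplicative windows, which gives
density one.

Just below an integer the correction sum is positive: omitting `j` lowers the mean by less than one,
so the reduced laws are still rising there. A deficit of at most `c / log n` is thereby overcome and
the mode exceeds the floor (`symm_lt_of_mean_near`). Steps of size about `θ / n` hit these windows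
infinitely often. -/

/-! ### Elementary symmetric functions and crude ratio bounds -/

/-- The `k`-th elementary symmetric function of the weights `w j`, `j ∈ s`. -/
noncomputable def symm (w : ℕ → ℝ) (s : Finset ℕ) (k : ℕ) : ℝ :=
  (∏ j ∈ s, (1 + Polynomial.C (w j) * Polynomial.X)).coeff k

theorem symm_zero (w : ℕ → ℝ) (s : Finset ℕ) : symm w s 0 = 1 := by
  simp [symm, Polynomial.coeff_zero_prod]

theorem symm_insert_succ (w : ℕ → ℝ) {s : Finset ℕ} {j : ℕ} (hj : j ∉ s) (k : ℕ) :
    symm w (insert j s) (k + 1) = symm w s (k + 1) + w j * symm w s k := by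
  simp [symm, Finset.prod_insert hj, add_mul, mul_assoc, Polynomial.coeff_X_mul]

theorem symm_succ_eq (w : ℕ → ℝ) {s : Finset ℕ} {j : ℕ} (hj : j ∈ s) (k : ℕ) :
    symm w s (k + 1) = symm w (s.erase j) (k + 1) + w j * symm w (s.erase j) k := by
  conv_lhs => rw [← Finset.insert_erase hj]
  exact symm_insert_succ w (Finset.notMem_erase j s) k

theorem symm_empty_succ (w : ℕ → ℝ) (k : ℕ) : symm w ∅ (k + 1) = 0 := by
  simp [symm, Polynomial.coeff_one]

theorem symm_nonneg {w : ℕ → ℝ} (hw : ∀ j, 0 ≤ w j) (s : Finset ℕ) (k : ℕ) :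
    0 ≤ symm w s k := by
  induction s using Finset.induction_on generalizing k with
  | empty => cases k <;> simp [symm_zero, symm_empty_succ]
  | insert j s hj ih =>
    cases k with
    | zero => simp [symm_zero]
    | succ k =>
      rw [symm_insert_succ w hj]
      exact add_nonneg (ih _) (mul_nonneg (hw j) (ih _))

theorem symm_erase_le {w : ℕ → ℝ} (hw : ∀ j, 0 ≤ w j) {s : Finset ℕ} {j : ℕ} (hj : j ∈ s)
    (k : ℕ) : symm w (s.erase j) k ≤ symm w s k := by
  cases k with
  | zero => simp [symm_zero]
  | succ k =>
    rw [symm_succ_eq w hj]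
    exact le_add_of_nonneg_right (mul_nonneg (hw j) (symm_nonneg hw _ _))

/-- Compare coefficients in the derivative of `∏ (1 + w j X)`. -/
theorem succ_mul_symm_succ (w : ℕ → ℝ) (s : Finset ℕ) (k : ℕ) :
    ((k : ℝ) + 1) * symm w s (k + 1) = ∑ j ∈ s, w j * symm w (s.erase j) k := by
  have h := congrArg (fun p => Polynomial.coeff p k)
    (Polynomial.derivative_prod_finset (s := s) (f := fun j => 1 + Polynomial.C (w j) * Polynomial.X))
  simp only [Polynomial.coeff_derivative, Polynomial.finsetSum_coeff] at h
  rw [mul_comm]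
  refine h.trans (Finset.sum_congr rfl fun j _ => ?_)
  simp [symm, Polynomial.coeff_mul_C, mul_comm (w j)]

theorem succ_mul_symm_succ_le {w : ℕ → ℝ} (hw : ∀ j, 0 ≤ w j) (s : Finset ℕ) (k : ℕ) :
    ((k : ℝ) + 1) * symm w s (k + 1) ≤ (∑ j ∈ s, w j) * symm w s k := by
  rw [succ_mul_symm_succ, Finset.sum_mul]
  exact Finset.sum_le_sum fun j hj => mul_le_mul_of_nonneg_left (symm_erase_le hw hj k) (hw j)

theorem le_succ_mul_symm_succ {w : ℕ → ℝ} (hw : ∀ j, 0 ≤ w j) (s : Finset ℕ) (k : ℕ) :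
    (∑ j ∈ s, w j) * symm w s (k + 1) - (∑ j ∈ s, w j ^ 2) * symm w s k ≤
      ((k : ℝ) + 2) * symm w s (k + 2) := by
  have h := succ_mul_symm_succ w s (k + 1)
  push_cast at h
  rw [show (k : ℝ) + 2 = k + 1 + 1 by ring, h, Finset.sum_mul, Finset.sum_mul,
    ← Finset.sum_sub_distrib]
  refine Finset.sum_le_sum fun j hj => ?_
  have h1 := symm_succ_eq w hj k
  have h2 := mul_le_mul_of_nonneg_left (symm_erase_le hw hj k) (sq_nonneg (w j))
  rw [h1]
  nlinarith

/-- The quadratic loss in `le_succ_mul_symm_succ` involves the previous coefficient; the inductive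
bound by twice the current one absorbs it into the factor `∑ w - 2 ∑ w²`. -/
theorem symm_le_two_mul_succ {w : ℕ → ℝ} (hw : ∀ j, 0 ≤ w j) (s : Finset ℕ) (k : ℕ)
    (hk : (k : ℝ) + 1 ≤ 2 * (∑ j ∈ s, w j - 2 * ∑ j ∈ s, w j ^ 2)) :
    symm w s k ≤ 2 * symm w s (k + 1) := by
  induction k with
  | zero =>
    have h := succ_mul_symm_succ w s 0
    have h2 : 0 ≤ ∑ j ∈ s, w j ^ 2 := Finset.sum_nonneg fun j _ => sq_nonneg _
    simp only [symm_zero] at h ⊢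
    simp at h hk
    linarith
  | succ k ih =>
    push_cast at hk
    have h1 := ih (by linarith)
    have h2 := le_succ_mul_symm_succ hw s k
    have h3 := mul_le_mul_of_nonneg_left h1 (Finset.sum_nonneg fun j (_ : j ∈ s) => sq_nonneg (w j))
    have h4 := mul_le_mul_of_nonneg_right hk (symm_nonneg hw s (k + 1))
    have h5 : ((k : ℝ) + 2) * symm w s (k + 1) ≤ ((k : ℝ) + 2) * (2 * symm w s (k + 2)) := by
      nlinarith
    exact le_of_mul_le_mul_left h5 (by positivity)

theorem mul_symm_le_succ_mul {w : ℕ → ℝ} (hw : ∀ j, 0 ≤ w j) (s : Finset ℕ) (k : ℕ)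
    (hk : (k : ℝ) ≤ 2 * (∑ j ∈ s, w j - 2 * ∑ j ∈ s, w j ^ 2)) :
    (∑ j ∈ s, w j - 2 * ∑ j ∈ s, w j ^ 2) * symm w s k ≤ ((k : ℝ) + 1) * symm w s (k + 1) := by
  have h2 : 0 ≤ ∑ j ∈ s, w j ^ 2 := Finset.sum_nonneg fun j _ => sq_nonneg _
  cases k with
  | zero =>
    have h := succ_mul_symm_succ w s 0
    simp only [symm_zero] at h ⊢
    simp at h ⊢
    linarith
  | succ k =>
    push_cast at hk ⊢
    have h1 := symm_le_two_mul_succ hw s k hk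
    have h3 := le_succ_mul_symm_succ hw s k
    have h4 := mul_le_mul_of_nonneg_left h1 h2
    rw [show (k : ℝ) + 1 + 1 = k + 2 by ring]
    nlinarith

theorem symm_pos {w : ℕ → ℝ} (hw : ∀ j, 0 ≤ w j) (s : Finset ℕ) (k : ℕ)
    (hk : (k : ℝ) ≤ 2 * (∑ j ∈ s, w j - 2 * ∑ j ∈ s, w j ^ 2)) : 0 < symm w s k := by
  induction k with
  | zero => simp [symm_zero]
  | succ k ih =>
    push_cast at hk
    have := symm_le_two_mul_succ hw s k hk
    linarith [ih (by linarith)]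

/-! ### Comparison with the Poisson law of the same mean -/

/-- The mean of the sum of independent Bernoulli variables with odds `w j`. -/
noncomputable def mean (w : ℕ → ℝ) (s : Finset ℕ) : ℝ := ∑ j ∈ s, w j / (1 + w j)

/-- Splitting `e_{k+1}` according to whether `j` is used turns each `w j * e_{k+1}^(j)` into its
share of the mean plus a second-order difference. -/
theorem succ_mul_symm_eq_mean {w : ℕ → ℝ} (hw : ∀ j, 0 ≤ w j) (s : Finset ℕ) (k : ℕ) :
    ((k : ℝ) + 2) * symm w s (k + 2) = mean w s * symm w s (k + 1) +
      ∑ j ∈ s, w j ^ 2 / (1 + w j) * (symm w (s.erase j) (k + 1) - symm w (s.erase j) k) := by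
  have h := succ_mul_symm_succ w s (k + 1)
  push_cast at h
  rw [show (k : ℝ) + 2 = k + 1 + 1 by ring, h, mean, Finset.sum_mul, ← Finset.sum_add_distrib]
  refine Finset.sum_congr rfl fun j hj => ?_
  rw [symm_succ_eq w hj k]
  have := hw j
  field_simp
  ring

theorem sum_sq_div_le {w : ℕ → ℝ} (hw : ∀ j, 0 ≤ w j) (s : Finset ℕ) :
    ∑ j ∈ s, w j ^ 2 / (1 + w j) ≤ ∑ j ∈ s, w j ^ 2 :=
  Finset.sum_le_sum fun j _ => div_le_self (sq_nonneg _) (by linarith [hw j])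

theorem mean_add_sum_sq_div {w : ℕ → ℝ} (hw : ∀ j, 0 ≤ w j) (s : Finset ℕ) :
    mean w s + ∑ j ∈ s, w j ^ 2 / (1 + w j) = ∑ j ∈ s, w j := by
  rw [mean, ← Finset.sum_add_distrib]
  refine Finset.sum_congr rfl fun j _ => ?_
  have := hw j
  field_simp

/-- Near the mean, consecutive ratios agree with those of the Poisson law of the same mean, up to
an error of second order. -/
theorem abs_succ_mul_symm_sub_le {w : ℕ → ℝ} (hw : ∀ j, 0 ≤ w j) (s : Finset ℕ) {B W D : ℝ}
    (hB : ∑ j ∈ s, w j ^ 2 ≤ B) (hW : ∀ j ∈ s, w j ≤ W) (k : ℕ)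
    (hD : |∑ j ∈ s, w j - (k + 1)| ≤ D)
    (hk : (k : ℝ) + 1 ≤ 2 * (∑ j ∈ s, w j - W - 2 * B)) :
    |((k : ℝ) + 2) * symm w s (k + 2) - mean w s * symm w s (k + 1)| ≤
      2 * B * (D + W + 2 * B) / (k + 1) * symm w s (k + 1) := by
  rw [succ_mul_symm_eq_mean hw, add_sub_cancel_left]
  -- Both crude bounds place the ratio for `s.erase j` within `(D + W + 2B)/(k+1)` of 1; the factor
  -- 2 pays for replacing index `k` by `k + 1`.
  have key : ∀ j ∈ s, |symm w (s.erase j) (k + 1) - symm w (s.erase j) k| ≤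
      2 * (D + W + 2 * B) / (k + 1) * symm w s (k + 1) := by
    intro j hj
    have e1 : ∑ i ∈ s.erase j, w i = ∑ i ∈ s, w i - w j := by
      rw [← Finset.add_sum_erase s w hj]; ring
    have e2 : ∑ i ∈ s.erase j, w i ^ 2 = ∑ i ∈ s, w i ^ 2 - w j ^ 2 := by
      rw [← Finset.add_sum_erase s (fun i => w i ^ 2) hj]; ring
    have hWj := hW j hj
    have hwj := hw j
    have hsq := sq_nonneg (w j)
    have hrange : (k : ℝ) + 1 ≤ 2 * (∑ i ∈ s.erase j, w i - 2 * ∑ i ∈ s.erase j, w i ^ 2) := by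
      rw [e1, e2]; linarith
    have up := succ_mul_symm_succ_le hw (s.erase j) k
    have lo := mul_symm_le_succ_mul hw (s.erase j) k (by linarith)
    have hr := symm_le_two_mul_succ hw (s.erase j) k hrange
    have hle := symm_erase_le hw hj (k + 1)
    have hnn := symm_nonneg hw (s.erase j) k
    rw [e1] at up
    rw [e1, e2] at lo
    obtain ⟨hD1, hD2⟩ := abs_le.1 hD
    have hk1 : (0 : ℝ) < (k : ℝ) + 1 := by positivity
    have hDnn : 0 ≤ D := le_trans (abs_nonneg _) hD
    have hB0 : 0 ≤ B := le_trans (Finset.sum_nonneg fun j _ => sq_nonneg _) hB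
    have hcst : 0 ≤ D + W + 2 * B := by linarith
    have a1 : ((k : ℝ) + 1) * |symm w (s.erase j) (k + 1) - symm w (s.erase j) k| ≤
        (D + W + 2 * B) * symm w (s.erase j) k := by
      have hmul : ((k : ℝ) + 1) * |symm w (s.erase j) (k + 1) - symm w (s.erase j) k| =
          |((k : ℝ) + 1) * (symm w (s.erase j) (k + 1) - symm w (s.erase j) k)| := by
        rw [abs_mul, abs_of_pos hk1]
      rw [hmul, abs_le]
      constructor
      · have := mul_le_mul_of_nonneg_right (show -(D + W + 2 * B) + (k + 1) ≤
          ∑ i ∈ s, w i - w j - 2 * (∑ i ∈ s, w i ^ 2 - w j ^ 2) by linarith) hnn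
        linarith
      · have := mul_le_mul_of_nonneg_right (show ∑ i ∈ s, w i - w j ≤
          (D + W + 2 * B) + (k + 1) by linarith) hnn
        linarith
    have a2 : (D + W + 2 * B) * symm w (s.erase j) k ≤
        (D + W + 2 * B) * (2 * symm w s (k + 1)) :=
      mul_le_mul_of_nonneg_left (by linarith) hcst
    rw [div_mul_eq_mul_div, le_div_iff₀ hk1]
    linarith
  have hnn := symm_nonneg hw s (k + 1)
  -- Nonnegativity of `W` is not assumed, so the sign of the bound comes from an element of `s`; the
  -- empty set is treated apart.
  have hc : 0 ≤ 2 * (D + W + 2 * B) / (k + 1) * symm w s (k + 1) ∨ s = ∅ := by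
    rcases s.eq_empty_or_nonempty with h | ⟨j, hj⟩
    · exact Or.inr h
    · exact Or.inl (le_trans (abs_nonneg _) (key j hj))
  rcases hc with hc | hc
  · calc _ ≤ ∑ j ∈ s, w j ^ 2 / (1 + w j) * (2 * (D + W + 2 * B) / (k + 1) * symm w s (k + 1)) := by
          refine (Finset.abs_sum_le_sum_abs _ _).trans (Finset.sum_le_sum fun j hj => ?_)
          have : 0 ≤ w j ^ 2 / (1 + w j) := div_nonneg (sq_nonneg _) (by linarith [hw j])
          rw [abs_mul, abs_of_nonneg this]
          exact mul_le_mul_of_nonneg_left (key j hj) this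
      _ ≤ B * (2 * (D + W + 2 * B) / (k + 1) * symm w s (k + 1)) := by
          rw [← Finset.sum_mul]
          exact mul_le_mul_of_nonneg_right ((sum_sq_div_le hw s).trans hB) hc
      _ = _ := by ring
  · subst hc
    simp [symm_empty_succ]

/-- A sum of independent Bernoulli variables whose mean is not too close to an integer has its
mode at the integer part of the mean. -/
theorem symm_unimodal {w : ℕ → ℝ} (hw : ∀ j, 0 ≤ w j) (s : Finset ℕ) {B W : ℝ}
    (hB : ∑ j ∈ s, w j ^ 2 ≤ B) (hW : ∀ j ∈ s, w j ≤ W) (hW0 : 0 ≤ W)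
    (hlarge : 2 * W + 8 * B + 2 ≤ ∑ j ∈ s, w j) (N : ℕ)
    (hN1 : N + 4 * B * (4 * B + W + 1) / ∑ j ∈ s, w j < mean w s)
    (hN2 : mean w s + 4 * B * (4 * B + W + 1) / ∑ j ∈ s, w j < N + 1) :
    (∀ k : ℕ, k + 1 ≤ N → 0 < symm w s k ∧ symm w s k < symm w s (k + 1)) ∧
      ∀ k : ℕ, N ≤ k → symm w s (k + 1) ≤ symm w s k := by
  have hB0 : 0 ≤ B := le_trans (Finset.sum_nonneg fun j _ => sq_nonneg _) hB
  set P := ∑ j ∈ s, w j with hP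
  set η := 4 * B * (4 * B + W + 1) / P with hη
  have hPpos : 0 < P := by linarith
  have hη0 : 0 ≤ η := by positivity
  have hmean := mean_add_sum_sq_div hw s
  have hq0 : 0 ≤ ∑ j ∈ s, w j ^ 2 / (1 + w j) :=
    Finset.sum_nonneg fun j _ => div_nonneg (sq_nonneg _) (by linarith [hw j])
  -- The precise estimate is needed only in this window, which contains the mean. There `D = 2B + 1`
  -- and `k ≥ P / 2`, which yields `η`; outside it the crude bounds decide.
  have hmid : ∀ k : ℕ, P - 2 * B ≤ k + 1 → (k : ℝ) + 1 ≤ P →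
      |((k : ℝ) + 1) * symm w s (k + 1) - mean w s * symm w s k| ≤ η * symm w s k := by
    intro k h1 h2
    obtain _ | k := k
    · exfalso; push_cast at h1; linarith
    push_cast at h1 h2 ⊢
    have h := abs_succ_mul_symm_sub_le hw s hB hW (D := 2 * B + 1) k
      (abs_le.2 ⟨by linarith, by linarith⟩) (by linarith)
    rw [show (k : ℝ) + 1 + 1 = k + 2 by ring]
    refine h.trans (mul_le_mul_of_nonneg_right ?_ (symm_nonneg hw _ _))
    rw [hη, div_le_div_iff₀ (by positivity) hPpos]
    have : P ≤ 2 * (k + 1) := by linarith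
    have h3 := mul_le_mul_of_nonneg_left this (show 0 ≤ 2 * B * (4 * B + W + 1) by positivity)
    linarith
  constructor
  · intro k hk
    have hk' : (k : ℝ) + 1 ≤ N := by exact_mod_cast hk
    have hpos : 0 < symm w s k := symm_pos hw s k (by linarith)
    refine ⟨hpos, ?_⟩
    have : ((k : ℝ) + 1) * symm w s k < ((k : ℝ) + 1) * symm w s (k + 1) := by
      by_cases hc : P - 2 * B ≤ k + 1
      · have h := (abs_le.1 (hmid k hc (by linarith))).1
        have h2 := mul_lt_mul_of_pos_right (show (k : ℝ) + 1 < mean w s - η by linarith) hpos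
        linarith
      · push Not at hc
        have h := mul_symm_le_succ_mul hw s k (by linarith)
        have h2 := mul_lt_mul_of_pos_right (show (k : ℝ) + 1 < P - 2 * ∑ j ∈ s, w j ^ 2 by linarith)
          hpos
        linarith
    exact lt_of_mul_lt_mul_left this (by positivity)
  · intro k hk
    have hk' : (N : ℝ) ≤ k := by exact_mod_cast hk
    have hnn := symm_nonneg hw s k
    have : ((k : ℝ) + 1) * symm w s (k + 1) ≤ ((k : ℝ) + 1) * symm w s k := by
      by_cases hc : (k : ℝ) + 1 ≤ P
      · have hs := sum_sq_div_le hw s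
        have h := (abs_le.1 (hmid k (by linarith) hc)).2
        have h2 := mul_le_mul_of_nonneg_right (show mean w s + η ≤ (k : ℝ) + 1 by linarith) hnn
        linarith
      · push Not at hc
        have h := succ_mul_symm_succ_le hw s k
        have h2 := mul_le_mul_of_nonneg_right hc.le hnn
        linarith
    exact le_of_mul_le_mul_left this (by positivity)

/-- If the mean is at, or only slightly below, the integer `k + 3`, then the mass at `k + 3`
exceeds the mass at `k + 2`. -/
theorem symm_lt_of_mean_near {w : ℕ → ℝ} (hw : ∀ j, 0 ≤ w j) (s : Finset ℕ) {B W : ℝ}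
    (hB : ∑ j ∈ s, w j ^ 2 ≤ B) (hW : ∀ j ∈ s, w j ≤ W) (k i : ℕ) (hi : i ∈ s)
    (hD : |∑ j ∈ s, w j - (k + 3)| ≤ B + 1)
    (hk : 8 * (1 + W) * (B + 1) * (3 * B + 2 * W + 3) ≤ k + 1)
    (hm : k + 3 - 1 / (4 * (1 + W)) ≤ mean w s)
    (hm' : k + 3 - w i ^ 2 / (1 + w i) * (1 / (2 * (1 + W) * (2 + W)) / (k + 2)) < mean w s) :
    symm w s (k + 2) < symm w s (k + 3) := by
  have hB0 : 0 ≤ B := le_trans (Finset.sum_nonneg fun j _ => sq_nonneg _) hB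
  have hW0 : 0 ≤ W := (hw i).trans (hW i hi)
  have hk' : 8 * (3 * B + 2 * W + 3) ≤ k + 1 := by
    refine le_trans ?_ hk
    have h1 : 1 ≤ (1 + W) * (B + 1) := by nlinarith [mul_nonneg hW0 hB0]
    have := mul_le_mul_of_nonneg_left h1 (show 0 ≤ 8 * (3 * B + 2 * W + 3) by positivity)
    linarith
  obtain ⟨hD1, hD2⟩ := abs_le.1 hD
  have herr : 2 * B * (B + 3 + W + W + 2 * B) / (k + 1) ≤ 1 / (4 * (1 + W)) := by
    rw [div_le_div_iff₀ (by positivity) (by positivity)]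
    have : 0 ≤ 8 * (1 + W) * (3 * B + 2 * W + 3) := by positivity
    linarith
  have hWW : 1 / (4 * (1 + W)) = 1 / (1 + W) / 4 := by field_simp
  -- Omitting `j` costs at most `1 - 1/(1+W)` of the mean. Of the remaining `1/(1+W)` above `k + 2`,
  -- a quarter pays for the deficit in `hm`, a quarter for the error `herr`, and half survives.
  have key : ∀ j ∈ s, 1 / (2 * (1 + W)) * symm w (s.erase j) (k + 1) ≤
      ((k : ℝ) + 2) * (symm w (s.erase j) (k + 2) - symm w (s.erase j) (k + 1)) := by
    intro j hj
    have e1 : ∑ i ∈ s.erase j, w i = ∑ i ∈ s, w i - w j := by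
      rw [← Finset.add_sum_erase s w hj]; ring
    have e2 : ∑ i ∈ s.erase j, w i ^ 2 = ∑ i ∈ s, w i ^ 2 - w j ^ 2 := by
      rw [← Finset.add_sum_erase s (fun i => w i ^ 2) hj]; ring
    have e3 : mean w (s.erase j) = mean w s - w j / (1 + w j) := by
      rw [mean, mean, ← Finset.add_sum_erase s (fun i => w i / (1 + w i)) hj]; ring
    have hWj := hW j hj
    have hwj := hw j
    have h := (abs_le.1 (abs_succ_mul_symm_sub_le hw (s.erase j) (B := B) (W := W)
      (D := B + 3 + W) (by rw [e2]; linarith [sq_nonneg (w j)])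
      (fun i hi => hW i (Finset.mem_of_mem_erase hi)) k
      (abs_le.2 ⟨by rw [e1]; linarith, by rw [e1]; linarith⟩) (by rw [e1]; linarith))).1
    have hnn := symm_nonneg hw (s.erase j) (k + 1)
    have hp : w j / (1 + w j) ≤ 1 - 1 / (1 + W) := by
      rw [show 1 - 1 / (1 + W) = W / (1 + W) by field_simp; ring,
        div_le_div_iff₀ (by positivity) (by positivity)]
      linarith
    have h1 := mul_le_mul_of_nonneg_right herr hnn
    have h2 := mul_le_mul_of_nonneg_right (show k + 2 + 1 / (2 * (1 + W)) + 1 / (4 * (1 + W)) ≤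
      mean w (s.erase j) by
        rw [e3, show 1 / (2 * (1 + W)) = 1 / (1 + W) / 2 by field_simp]; linarith) hnn
    linarith
  have hk2 : (0 : ℝ) < (k : ℝ) + 2 := by positivity
  have hstar := succ_mul_symm_eq_mean hw s (k + 1)
  push_cast at hstar
  have hposw : ∀ j, 0 ≤ w j ^ 2 / (1 + w j) :=
    fun j => div_nonneg (sq_nonneg _) (by linarith [hw j])
  have hdiff : ∀ j ∈ s, 1 / (2 * (1 + W)) * symm w (s.erase j) (k + 1) / (k + 2) ≤
      symm w (s.erase j) (k + 2) - symm w (s.erase j) (k + 1) := by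
    intro j hj
    rw [div_le_iff₀ hk2]
    linarith [key j hj]
  have hdiff0 : ∀ j ∈ s, 0 ≤ symm w (s.erase j) (k + 2) - symm w (s.erase j) (k + 1) := by
    intro j hj
    have := symm_nonneg hw (s.erase j) (k + 1)
    exact le_trans (by positivity) (hdiff j hj)
  -- All correction terms are nonnegative, so the single term `i` already bounds the sum from below.
  have hsingle := Finset.single_le_sum (f := fun j => w j ^ 2 / (1 + w j) *
    (symm w (s.erase j) (k + 2) - symm w (s.erase j) (k + 1)))
    (fun j hj => mul_nonneg (hposw j) (hdiff0 j hj)) hi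
  have hlow : symm w s (k + 2) ≤ (2 + W) * symm w (s.erase i) (k + 1) := by
    have hnn := symm_nonneg hw (s.erase i) (k + 1)
    have h1 := symm_succ_eq w hi (k + 1)
    have h2 := succ_mul_symm_succ_le hw (s.erase i) (k + 1)
    have e1 : ∑ j ∈ s.erase i, w j = ∑ j ∈ s, w j - w i := by
      rw [← Finset.add_sum_erase s w hi]; ring
    push_cast at h2
    rw [e1] at h2
    have h3 := mul_le_mul_of_nonneg_right (show ∑ j ∈ s, w j - w i ≤ (k + 2) * 2 by
      linarith [hw i]) hnn
    have h4 : ((k : ℝ) + 2) * symm w (s.erase i) (k + 2) ≤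
        (k + 2) * (2 * symm w (s.erase i) (k + 1)) := by
      rw [show (k : ℝ) + 2 = k + 1 + 1 by ring] at h3 ⊢
      linarith
    have h5 := le_of_mul_le_mul_left h4 hk2
    have h6 := mul_le_mul_of_nonneg_right (hW i hi) hnn
    rw [h1]
    linarith
  have hpos : 0 < symm w s (k + 2) := by
    refine symm_pos hw s (k + 2) ?_
    push_cast
    linarith
  have hlow2 : 1 / (2 * (1 + W) * (2 + W)) / (k + 2) * symm w s (k + 2) ≤
      symm w (s.erase i) (k + 2) - symm w (s.erase i) (k + 1) := by
    refine le_trans ?_ (hdiff i hi)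
    have := mul_le_mul_of_nonneg_left hlow
      (show 0 ≤ 1 / (2 * (1 + W) * (2 + W)) / ((k : ℝ) + 2) by positivity)
    refine this.trans (le_of_eq ?_)
    field_simp
  have hlow3 := mul_le_mul_of_nonneg_left hlow2 (hposw i)
  have hfin : ((k : ℝ) + 3) * symm w s (k + 2) < (k + 3) * symm w s (k + 3) := by
    have := mul_lt_mul_of_pos_right hm' hpos
    rw [show (k : ℝ) + 1 + 2 = k + 3 by ring] at hstar
    rw [show k + 1 + 2 = k + 3 by ring, show k + 1 + 1 = k + 2 by ring] at hstar
    rw [hstar]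
    linarith
  exact lt_of_mul_lt_mul_left hfin (by positivity)

/-! ### Digamma asymptotics -/

/-- The digamma function on the positive reals. -/
noncomputable def psi (x : ℝ) : ℝ := deriv Real.Gamma x / Real.Gamma x

theorem hasDerivAt_log_Gamma {x : ℝ} (hx : 0 < x) :
    HasDerivAt (Real.log ∘ Real.Gamma) (psi x) x := by
  have hd : DifferentiableAt ℝ Real.Gamma x :=
    Real.differentiableAt_Gamma fun m => by
      have : (0 : ℝ) ≤ m := m.cast_nonneg
      linarith
  exact hd.hasDerivAt.log (Real.Gamma_pos_of_pos hx).ne'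

theorem log_Gamma_add_one {x : ℝ} (hx : 0 < x) :
    (Real.log ∘ Real.Gamma) (x + 1) = Real.log x + (Real.log ∘ Real.Gamma) x := by
  simp only [Function.comp_apply]
  rw [Real.Gamma_add_one hx.ne', Real.log_mul hx.ne' (Real.Gamma_pos_of_pos hx).ne']

theorem psi_add_one {x : ℝ} (hx : 0 < x) : psi (x + 1) = psi x + 1 / x := by
  have h1 : HasDerivAt (fun y => (Real.log ∘ Real.Gamma) (y + 1)) (psi (x + 1)) x :=
    (hasDerivAt_log_Gamma (by linarith : 0 < x + 1)).comp_add_const x 1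
  have h2 := (Real.hasDerivAt_log hx.ne').add (hasDerivAt_log_Gamma hx)
  have h3 : (fun y => (Real.log ∘ Real.Gamma) (y + 1)) =ᶠ[𝓝 x]
      (fun y => Real.log y + (Real.log ∘ Real.Gamma) y) := by
    filter_upwards [lt_mem_nhds hx] with y hy using log_Gamma_add_one hy
  rw [(h1.congr_of_eventuallyEq h3.symm).unique h2, one_div, add_comm]

/-- By convexity of `log Γ`, its slope over `[x, x + 1]`, which is `log x`, lies between the
derivatives at the two ends. -/
theorem psi_le_log {x : ℝ} (hx : 0 < x) : psi x ≤ Real.log x := by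
  have h := Real.convexOn_log_Gamma.le_slope_of_hasDerivAt (Set.mem_Ioi.2 hx)
    (Set.mem_Ioi.2 (by linarith : 0 < x + 1)) (by linarith) (hasDerivAt_log_Gamma hx)
  rwa [slope_def_field, log_Gamma_add_one hx, add_sub_cancel_left, add_sub_cancel_right,
    div_one] at h

theorem log_le_psi_add_one {x : ℝ} (hx : 0 < x) : Real.log x ≤ psi (x + 1) := by
  have h := Real.convexOn_log_Gamma.slope_le_of_hasDerivAt (Set.mem_Ioi.2 hx)
    (Set.mem_Ioi.2 (by linarith : 0 < x + 1)) (by linarith)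
    (hasDerivAt_log_Gamma (by linarith : 0 < x + 1))
  rwa [slope_def_field, log_Gamma_add_one hx, add_sub_cancel_left, add_sub_cancel_right,
    div_one] at h

theorem psi_add_nat {x : ℝ} (hx : 0 < x) (n : ℕ) :
    psi (x + n) = psi x + ∑ j ∈ Finset.range n, 1 / (x + j) := by
  induction n with
  | zero => simp
  | succ n ih =>
    rw [Finset.sum_range_succ, ← add_assoc, ← ih, Nat.cast_succ, ← add_assoc,
      psi_add_one (by positivity)]

/-- `|ψ(θ + n) - log n| ≤ (θ + 1 + 1 / θ) / n`. -/
theorem abs_psi_add_nat_sub_log_le {θ : ℝ} (hθ : 0 < θ) {n : ℕ} (hn : 1 ≤ n) :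
    |psi (θ + n) - Real.log n| ≤ (θ + 1 + 1 / θ) / n := by
  have hn' : (1 : ℝ) ≤ n := by exact_mod_cast hn
  have hn0 : (0 : ℝ) < n := by linarith
  have hinv : 0 < 1 / θ := by positivity
  rw [abs_le]
  constructor
  · have hx : 0 < θ + n := by positivity
    have h1 := log_le_psi_add_one hx
    rw [psi_add_one hx] at h1
    have h2 : Real.log n ≤ Real.log (θ + n) := Real.log_le_log hn0 (by linarith)
    have h3 : 1 / (θ + n) ≤ (θ + 1 + 1 / θ) / n := by
      rw [div_le_div_iff₀ hx hn0]
      have : 0 < 1 / θ * (θ + n) := by positivity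
      nlinarith
    linarith
  · have h1 := psi_le_log (x := θ + n) (by positivity)
    have h2 : Real.log (θ + n) = Real.log n + Real.log (1 + θ / n) := by
      rw [← Real.log_mul hn0.ne' (by positivity)]
      congr 1
      field_simp
      ring
    have h3 := Real.log_le_sub_one_of_pos (show 0 < 1 + θ / n by positivity)
    have h4 : θ / n ≤ (θ + 1 + 1 / θ) / n := by gcongr; linarith
    linarith

theorem sum_inv_sq_le (n : ℕ) : ∑ j ∈ Finset.Icc 1 n, (1 / (j : ℝ)) ^ 2 ≤ 2 := by
  -- The strengthened bound telescopes; at `n = 0` it reads `0 ≤ 2` because `1 / 0 = 0`.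
  have : ∑ j ∈ Finset.Icc 1 n, (1 / (j : ℝ)) ^ 2 ≤ 2 - 1 / (n : ℝ) := by
    induction n with
    | zero => simp
    | succ n ih =>
      rw [Finset.sum_Icc_succ_top (by omega)]
      rcases n.eq_zero_or_pos with rfl | hn
      · norm_num
      · have hn' : (0 : ℝ) < n := by exact_mod_cast hn
        push_cast
        have : (1 / ((n : ℝ) + 1)) ^ 2 ≤ 1 / (n : ℝ) - 1 / ((n : ℝ) + 1) := by
          rw [div_pow, one_pow, div_sub_div _ _ (by positivity) (by positivity),
            div_le_div_iff₀ (by positivity) (by positivity)]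
          nlinarith
        linarith
  have h : (0 : ℝ) ≤ 1 / (n : ℝ) := by positivity
  linarith

/-! ### The Ewens law as a Bernoulli sum -/

/-- The odds of the Bernoulli summands of `K_n(θ) - 1`. -/
noncomputable def odds (θ : ℝ) (j : ℕ) : ℝ := θ * (1 / (j : ℝ))

theorem odds_nonneg {θ : ℝ} (hθ : 0 < θ) (j : ℕ) : 0 ≤ odds θ j := by
  unfold odds; positivity

theorem odds_le {θ : ℝ} (hθ : 0 < θ) (j : ℕ) : odds θ j ≤ θ := by
  unfold odds
  refine mul_le_of_le_one_right hθ.le ?_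
  rcases j.eq_zero_or_pos with rfl | hj
  · simp
  · have : (1 : ℝ) ≤ j := by exact_mod_cast hj
    rw [div_le_one (by linarith)]
    exact this

theorem sum_odds_sq_le (θ : ℝ) (M : ℕ) : ∑ j ∈ Finset.Icc 1 M, odds θ j ^ 2 ≤ 2 * θ ^ 2 := by
  simp only [odds, mul_pow _ _ 2, ← Finset.mul_sum]
  linarith [mul_le_mul_of_nonneg_left (sum_inv_sq_le M) (sq_nonneg θ)]

/-- Both sides are the coefficients of `∏ (θ X + j) = M! ∏ (1 + (θ / j) X)`; the induction matches
their recurrences. -/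
theorem pow_mul_stirlingFirst (θ : ℝ) (M k : ℕ) :
    θ ^ k * (Nat.stirlingFirst (M + 1) (k + 1) : ℝ) =
      (M.factorial : ℝ) * symm (odds θ) (Finset.Icc 1 M) k := by
  induction M generalizing k with
  | zero =>
    cases k with
    | zero => simp [symm_zero, Nat.stirlingFirst]
    | succ k => simp [symm_empty_succ, Nat.stirlingFirst]
  | succ M ih =>
    have hs : Finset.Icc 1 (M + 1) = insert (M + 1) (Finset.Icc 1 M) := by
      ext; simp; omega
    have hM : ((M : ℝ) + 1) ≠ 0 := by positivity
    rw [Nat.stirlingFirst_succ_succ, hs, Nat.factorial_succ]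
    push_cast
    cases k with
    | zero =>
      have h := ih 0
      simp only [symm_zero, pow_zero, one_mul, mul_one] at h ⊢
      simp [h]
    | succ k =>
      rw [symm_insert_succ _ (by simp), mul_add, pow_succ]
      have h1 := ih (k + 1)
      have h2 := ih k
      rw [pow_succ] at h1
      have h3 : odds θ (M + 1) * (M + 1) = θ := by
        simp only [odds]; push_cast; field_simp
      linear_combination (M + 1 : ℝ) * h1 + θ * h2 -
        (M.factorial : ℝ) * symm (odds θ) (Finset.Icc 1 M) k * h3

theorem exists_prob_eq {θ : ℝ} (hθ : 0 < θ) (M : ℕ) :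
    ∃ c : ℝ, 0 < c ∧ ∀ k, prob θ (M + 1) (k + 1) = c * symm (odds θ) (Finset.Icc 1 M) k := by
  have hpos := ascPochhammer_pos (M + 1) θ hθ
  refine ⟨θ / (ascPochhammer ℝ (M + 1)).eval θ * M.factorial, by positivity, fun k => ?_⟩
  rw [mul_assoc, ← pow_mul_stirlingFirst, prob, pow_succ]
  ring

theorem le_of_symm_pos {θ : ℝ} {M k : ℕ}
    (h : 0 < symm (odds θ) (Finset.Icc 1 M) k) : k ≤ M := by
  by_contra hk
  have h1 := pow_mul_stirlingFirst θ M k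
  rw [Nat.stirlingFirst_eq_zero_of_lt (by omega)] at h1
  simp at h1
  rcases h1 with h1 | h1
  · exact Nat.factorial_ne_zero _ h1
  · exact h.ne' h1

/-- Strict growth up to `N` makes this maximizer the least one; the shift by one passes from `K_n -
1` to `K_n`. -/
theorem mode_eq_of_unimodal {θ : ℝ} (hθ : 0 < θ) {M N : ℕ}
    (h1 : ∀ k : ℕ, k + 1 ≤ N → 0 < symm (odds θ) (Finset.Icc 1 M) k ∧
      symm (odds θ) (Finset.Icc 1 M) k < symm (odds θ) (Finset.Icc 1 M) (k + 1))
    (h2 : ∀ k : ℕ, N ≤ k →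
      symm (odds θ) (Finset.Icc 1 M) (k + 1) ≤ symm (odds θ) (Finset.Icc 1 M) k) :
    mode θ (M + 1) = N + 1 := by
  obtain ⟨c, hc, hp⟩ := exists_prob_eq hθ M
  have hpos : 0 < symm (odds θ) (Finset.Icc 1 M) N := by
    cases N with
    | zero => simp [symm_zero]
    | succ N => exact (h1 N le_rfl).1.trans (h1 N le_rfl).2
  have hNM := le_of_symm_pos hpos
  have hlt : ∀ k, k < N →
      symm (odds θ) (Finset.Icc 1 M) k < symm (odds θ) (Finset.Icc 1 M) N := by
    suffices H : ∀ m ≤ N, ∀ k < m,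
        symm (odds θ) (Finset.Icc 1 M) k < symm (odds θ) (Finset.Icc 1 M) m from H N le_rfl
    intro m
    induction m with
    | zero => intro _ k hk; omega
    | succ m ih =>
      intro hm k hk
      have h := (h1 m hm).2
      rcases Nat.lt_succ_iff_lt_or_eq.1 hk with hk | rfl
      · exact (ih (by omega) k hk).trans h
      · exact h
  have hle : ∀ k, N ≤ k →
      symm (odds θ) (Finset.Icc 1 M) k ≤ symm (odds θ) (Finset.Icc 1 M) N := by
    intro k hk
    induction k, hk using Nat.le_induction with
    | base => exact le_rfl
    | succ k hk ih => exact (h2 k hk).trans ih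
  obtain ⟨hmem, hmin⟩ := mode_isLeast θ (n := M + 1) (by omega)
  have hNmode : IsMode θ (M + 1) (N + 1) := by
    refine ⟨⟨by omega, by omega⟩, fun j hj => ?_⟩
    obtain ⟨j, rfl⟩ := Nat.exists_eq_add_of_le' hj.1
    rw [hp, hp]
    refine mul_le_mul_of_nonneg_left ?_ hc.le
    rcases lt_or_ge j N with h | h
    · exact (hlt j h).le
    · exact hle j h
  refine le_antisymm (hmin hNmode) ?_
  by_contra hlt'
  push Not at hlt'
  obtain ⟨⟨hm1, -⟩, hmax⟩ := hmem
  obtain ⟨u, hu⟩ := Nat.exists_eq_add_of_le' hm1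
  rw [hu] at hmax hlt'
  have h := hmax (N + 1) hNmode.1
  rw [hp, hp] at h
  exact absurd (le_of_mul_le_mul_left h hc) (not_le.2 (hlt u (by omega)))

theorem mode_ne_of_lt {θ : ℝ} (hθ : 0 < θ) {M k : ℕ}
    (h : symm (odds θ) (Finset.Icc 1 M) k < symm (odds θ) (Finset.Icc 1 M) (k + 1)) :
    mode θ (M + 1) ≠ k + 1 := by
  intro hk
  obtain ⟨c, hc, hp⟩ := exists_prob_eq hθ M
  have hkM := le_of_symm_pos ((symm_nonneg (odds_nonneg hθ) _ _).trans_lt h)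
  obtain ⟨⟨-, hmax⟩, -⟩ := mode_isLeast θ (n := M + 1) (by omega)
  rw [hk] at hmax
  have := hmax (k + 1 + 1) ⟨by omega, by omega⟩
  rw [hp, hp] at this
  exact absurd (le_of_mul_le_mul_left this hc) (not_le.2 h)

/-! ### The mode in terms of the approximate mean -/

/-- The approximate mean `θ log n - θ ψ(θ)` of `K_n(θ)`. -/
noncomputable def approxMean (θ : ℝ) (n : ℕ) : ℝ := θ * Real.log n - θ * psi θ

/-- The success probabilities are `θ / (θ + j)`, whose sum is a digamma difference; the missing term
`j = 0` equals 1 and accounts for the `- 1`. -/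
theorem abs_mean_sub_approxMean_le {θ : ℝ} (hθ : 0 < θ) (M : ℕ) :
    |mean (odds θ) (Finset.Icc 1 M) - (approxMean θ (M + 1 : ℕ) - 1)| ≤
      θ * (θ + 1 + 1 / θ) / (M + 1 : ℕ) := by
  have h1 := psi_add_nat hθ (M + 1)
  rw [Finset.sum_range_succ'] at h1
  have h2 : mean (odds θ) (Finset.Icc 1 M) =
      θ * ∑ j ∈ Finset.range M, 1 / (θ + (j + 1 : ℕ)) := by
    rw [mean, Finset.mul_sum, Finset.range_eq_Ico, Finset.sum_Ico_add'
      (fun j : ℕ => θ * (1 / (θ + (j : ℝ)))) 0 M 1]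
    refine Finset.sum_congr (by ext; simp; try omega) fun j hj => ?_
    have : (1 : ℝ) ≤ j := by exact_mod_cast (Finset.mem_Icc.1 hj).1
    simp only [odds]
    field_simp
    ring
  have h3 := abs_psi_add_nat_sub_log_le hθ (n := M + 1) (by omega)
  rw [h2]
  have h4 : θ * ∑ j ∈ Finset.range M, 1 / (θ + (j + 1 : ℕ)) - (approxMean θ (M + 1 : ℕ) - 1) =
      θ * (psi (θ + (M + 1 : ℕ)) - Real.log (M + 1 : ℕ)) := by
    rw [h1, approxMean]
    simp
    field_simp
    ring
  rw [h4, abs_mul, abs_of_pos hθ, mul_div_assoc]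
  exact mul_le_mul_of_nonneg_left h3 hθ.le

theorem mean_le_sum {w : ℕ → ℝ} (hw : ∀ j, 0 ≤ w j) (s : Finset ℕ) :
    mean w s ≤ ∑ j ∈ s, w j :=
  Finset.sum_le_sum fun j _ => div_le_self (hw j) (by linarith [hw j])

theorem sum_le_mean_add {w : ℕ → ℝ} (hw : ∀ j, 0 ≤ w j) (s : Finset ℕ) :
    ∑ j ∈ s, w j ≤ mean w s + ∑ j ∈ s, w j ^ 2 := by
  rw [← mean_add_sum_sq_div hw]
  linarith [sum_sq_div_le hw s]

theorem tendsto_log_natCast : Tendsto (fun n : ℕ => Real.log n) atTop atTop :=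
  Real.tendsto_log_atTop.comp tendsto_natCast_atTop_atTop

theorem tendsto_approxMean {θ : ℝ} (hθ : 0 < θ) : Tendsto (approxMean θ) atTop atTop :=
  tendsto_atTop_add_const_right _ _ (tendsto_log_natCast.const_mul_atTop hθ)

theorem eventually_div_le {a b : ℝ} (hb : 0 < b) :
    ∀ᶠ n : ℕ in atTop, a / n ≤ b / Real.log n := by
  have h := (Real.isLittleO_log_id_atTop.tendsto_div_nhds_zero).comp tendsto_natCast_atTop_atTop
  have h2 := h.const_mul a
  rw [mul_zero] at h2
  filter_upwards [h2.eventually_lt_const hb, tendsto_log_natCast.eventually_gt_atTop 0] with n h3 h4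
  simp only [Function.comp_apply, id] at h3
  rw [le_div_iff₀ h4]
  calc _ = a * (Real.log n / n) := by ring
    _ ≤ b := h3.le

/-- Away from the integers, the integer part of `θ log n - θ ψ(θ)` is the mode. -/
theorem mode_eq_of_far {θ : ℝ} (hθ : 0 < θ) :
    ∃ C : ℝ, 0 < C ∧ ∀ᶠ n : ℕ in atTop, ∀ N : ℤ, N + C / Real.log n ≤ approxMean θ n →
      approxMean θ n ≤ N + 1 - C / Real.log n → (mode θ n : ℤ) = N := by
  set B := 2 * θ ^ 2 with hB
  set A := 4 * B * (4 * B + θ + 1) with hA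
  set c₀ := θ * (θ + 1 + 1 / θ) with hc₀
  have hBpos : 0 < B := by positivity
  have hApos : 0 < A := by positivity
  -- The first part dominates `η`, as the sum of the odds is at least `(θ / 2) log n`. Of the 2, one
  -- unit covers the `O(1 / n)` error of the mean, the other gives strictness.
  refine ⟨A / (θ / 2) + 2, by positivity, ?_⟩
  filter_upwards [eventually_ge_atTop 1, eventually_div_le (a := c₀) one_pos,
    (tendsto_log_natCast.const_mul_atTop (show 0 < θ / 2 by positivity)).eventually_ge_atTop
      (max (2 * θ + 8 * B + 2) (θ * psi θ + 2)),
    tendsto_log_natCast.eventually_gt_atTop 1, (tendsto_approxMean hθ).eventually_ge_atTop 2]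
    with n hn1 hc hlog hlog1 hm2 N hN1 hN2
  obtain ⟨M, rfl⟩ := Nat.exists_eq_add_of_le' hn1
  have hl1 := (le_max_left _ _).trans hlog
  have hl2 := (le_max_right _ _).trans hlog
  obtain ⟨hm, hm'⟩ := abs_le.1 (abs_mean_sub_approxMean_le hθ M)
  set L := Real.log (M + 1 : ℕ) with hL
  have hLpos : 0 < L := by linarith
  have h1L : 1 / L ≤ 1 := by rw [div_le_one hLpos]; exact hlog1.le
  have hmean_ge : θ / 2 * L ≤ mean (odds θ) (Finset.Icc 1 M) := by
    have : approxMean θ (M + 1 : ℕ) = θ * L - θ * psi θ := rfl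
    linarith
  have hsum := hmean_ge.trans (mean_le_sum (odds_nonneg hθ) _)
  have hsplit : (A / (θ / 2) + 2) / L = A / (θ / 2 * L) + 2 * (1 / L) := by field_simp
  have hA2 : A / ∑ j ∈ Finset.Icc 1 M, odds θ j ≤ A / (θ / 2 * L) := by gcongr
  have h1Lpos : 0 < 1 / L := by positivity
  have hA0 : 0 < A / (θ / 2 * L) := by positivity
  have hNpos : 1 ≤ N := by
    have : (0 : ℝ) < N := by linarith
    exact_mod_cast this
  obtain ⟨K, hK⟩ := Int.eq_ofNat_of_zero_le (show 0 ≤ N - 1 by linarith)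
  have hKR : (N : ℝ) = K + 1 := by
    have : N = K + 1 := by linarith
    exact_mod_cast this
  obtain ⟨u1, u2⟩ := symm_unimodal (odds_nonneg hθ) (Finset.Icc 1 M) (sum_odds_sq_le θ M)
    (fun j _ => odds_le hθ j) hθ.le (by linarith) K (by linarith) (by linarith)
  rw [mode_eq_of_unimodal hθ u1 u2]
  push_cast
  linarith

/-- Slightly below an integer `N`, the mode is not `N - 1`. -/
theorem mode_ne_of_near {θ : ℝ} (hθ : 0 < θ) :
    ∃ c : ℝ, 0 < c ∧ ∀ᶠ n : ℕ in atTop, ∀ N : ℤ, approxMean θ n < N →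
      N - c / Real.log n ≤ approxMean θ n → (mode θ n : ℤ) ≠ N - 1 := by
  set B := 2 * θ ^ 2 with hB
  set c₀ := θ * (θ + 1 + 1 / θ) with hc₀
  set c₁ := θ ^ 2 / (1 + θ) * (1 / (2 * (1 + θ) * (2 + θ))) with hc₁
  -- Since `k + 2 ≤ 2 θ log n`, the gain `c₁ / (k + 2)` from the term `j = 1` is at least `4c / log
  -- n`, while the deficit and the error of the mean total at most `2c / log n`.
  set c := c₁ / (8 * θ) with hc
  have hBpos : 0 < B := by positivity
  have hc₁pos : 0 < c₁ := by positivity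
  have hcpos : 0 < c := by positivity
  refine ⟨c, hcpos, ?_⟩
  filter_upwards [eventually_ge_atTop 2, eventually_div_le (a := c₀) hcpos,
    (tendsto_log_natCast.const_mul_atTop hθ).eventually_ge_atTop (- (θ * psi θ) + 1),
    (tendsto_log_natCast).eventually_gt_atTop (max 1 (8 * c * (1 + θ) + 2 * c)),
    (tendsto_approxMean hθ).eventually_ge_atTop
      (8 * (1 + θ) * (B + 1) * (3 * B + 2 * θ + 3) + 4)]
    with n hn1 hcn hl hlog1 hm2 N hN1 hN2
  obtain ⟨M, rfl⟩ := Nat.exists_eq_add_of_le' (show 1 ≤ n by omega)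
  obtain ⟨hm, hm'⟩ := abs_le.1 (abs_mean_sub_approxMean_le hθ M)
  have happ : approxMean θ (M + 1 : ℕ) = θ * Real.log (M + 1 : ℕ) - θ * psi θ := rfl
  set L := Real.log (M + 1 : ℕ) with hL
  have hL1 := (le_max_left _ _).trans_lt hlog1
  have hL2 := (le_max_right _ _).trans_lt hlog1
  have hLpos : 0 < L := by linarith
  have hcL : 2 * (c / L) ≤ 1 / (4 * (1 + θ)) := by
    rw [← mul_div_assoc, div_le_div_iff₀ hLpos (by positivity)]
    linarith
  have hcL1 : 2 * (c / L) ≤ 1 := by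
    rw [← mul_div_assoc, div_le_one hLpos]
    nlinarith
  have hbig : 0 < 8 * (1 + θ) * (B + 1) * (3 * B + 2 * θ + 3) := by positivity
  obtain ⟨k, hk⟩ := Int.eq_ofNat_of_zero_le (show 0 ≤ N - 4 by
    have : (4 : ℝ) < N := by linarith
    have : 4 < N := by exact_mod_cast this
    linarith)
  have hN : N = k + 4 := by linarith
  have hNR : (N : ℝ) = k + 4 := by exact_mod_cast hN
  have hw1 : odds θ 1 = θ := by simp [odds]
  have hkL : (k : ℝ) + 2 ≤ 2 * θ * L := by linarith
  have hc1k : 4 * (c / L) ≤ c₁ / (k + 2) := by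
    rw [← mul_div_assoc, div_le_div_iff₀ hLpos (by positivity)]
    have := mul_le_mul_of_nonneg_left hkL (show 0 ≤ 4 * c by positivity)
    refine this.trans (le_of_eq ?_)
    rw [hc]
    field_simp
    ring
  have hcLpos : 0 < c / L := by positivity
  have hsum1 := mean_le_sum (odds_nonneg hθ) (Finset.Icc 1 M)
  have hsum2 := sum_le_mean_add (odds_nonneg hθ) (Finset.Icc 1 M)
  have hsq := sum_odds_sq_le θ M
  have := symm_lt_of_mean_near (odds_nonneg hθ) (Finset.Icc 1 M) (sum_odds_sq_le θ M)
    (fun j _ => odds_le hθ j) k 1 (by simp; omega)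
    (abs_le.2 ⟨by linarith, by linarith⟩) (by linarith) (by linarith) (by
      rw [hw1, ← mul_div_assoc, ← hc₁]
      linarith)
  have hne := mode_ne_of_lt hθ this
  intro h
  apply hne
  have : (mode θ (M + 1) : ℤ) = (k + 2 + 1 : ℕ) := by push_cast; linarith
  exact_mod_cast this

/-! ### Rounding, and the mode away from ties -/

theorem modeApprox_eq (θ : ℝ) (n : ℕ) : modeApprox θ n = approxMean θ n - 1 / 2 := by
  simp only [modeApprox, approxMean, psi]
  ring

theorem floor_approxMean_eq (θ : ℝ) (n : ℕ) :
    ⌊θ * Real.log n - θ * deriv Real.Gamma θ / Real.Gamma θ⌋ = ⌊approxMean θ n⌋ := by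
  rw [approxMean, psi, mul_div_assoc]

/-- The excluded case is that of integral `x`, where the tie is rounded down to `x - 1`. -/
theorem nint_sub_half_eq_floor {x : ℝ} (hx : Int.fract (x - 1 / 2) ≠ 1 / 2) :
    nint (x - 1 / 2) = ⌊x⌋ := by
  have h0 := Int.fract_nonneg (x - 1 / 2)
  have h1 := Int.fract_lt_one (x - 1 / 2)
  have h2 := Int.floor_add_fract (x - 1 / 2)
  unfold nint
  symm
  split_ifs with h
  · have := lt_of_le_of_ne h hx
    rw [Int.floor_eq_iff]
    constructor <;> linarith
  · push Not at h
    have hc : ⌈x - 1 / 2⌉ = ⌊x - 1 / 2⌋ + 1 := by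
      rw [Int.ceil_eq_iff]
      push_cast
      constructor <;> linarith
    rw [hc, Int.floor_eq_iff]
    push_cast
    constructor <;> linarith

theorem mode_eq_nint_of_far {θ : ℝ} (hθ : 0 < θ) :
    ∃ C₀ : ℝ, 0 < C₀ ∧ ∀ n : ℕ, 2 ≤ n →
      |Int.fract (modeApprox θ n) - 1 / 2| > C₀ / Real.log n →
        (mode θ n : ℤ) = nint (modeApprox θ n) ∧
        nint (modeApprox θ n) = ⌊approxMean θ n⌋ := by
  obtain ⟨C, hC, hev⟩ := mode_eq_of_far hθ
  obtain ⟨n₀, hn₀⟩ := eventually_atTop.1 hev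
  -- The added logarithm makes the threshold at least 1 for `n < n₀`, where the hypothesis then
  -- fails: the distance to `1/2` never exceeds `1/2`.
  refine ⟨C + Real.log (n₀ + 1 : ℕ), ?_, fun n hn hfar => ?_⟩
  · exact add_pos_of_pos_of_nonneg hC (Real.log_natCast_nonneg _)
  have hlog : 0 < Real.log n := Real.log_pos (by exact_mod_cast hn)
  have f0 := Int.fract_nonneg (modeApprox θ n)
  have f1 := Int.fract_lt_one (modeApprox θ n)
  have habs : |Int.fract (modeApprox θ n) - 1 / 2| ≤ 1 / 2 :=
    abs_le.2 ⟨by linarith, by linarith⟩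
  have hn0 : n₀ ≤ n := by
    by_contra hlt
    push Not at hlt
    have h1 : Real.log n ≤ Real.log (n₀ + 1 : ℕ) :=
      Real.log_le_log (by positivity) (by exact_mod_cast (by omega : n ≤ n₀ + 1))
    have : 1 ≤ (C + Real.log (n₀ + 1 : ℕ)) / Real.log n := by
      rw [le_div_iff₀ hlog]; linarith
    linarith
  have hCle : C / Real.log n ≤ (C + Real.log (n₀ + 1 : ℕ)) / Real.log n := by
    gcongr
    linarith [Real.log_natCast_nonneg (n₀ + 1)]
  have hCpos : 0 < C / Real.log n := by positivity
  have hfar' := hCle.trans_lt hfar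
  have hne : Int.fract (modeApprox θ n) ≠ 1 / 2 := by
    intro h
    rw [h] at hfar'
    simp at hfar'
    linarith
  rw [modeApprox_eq] at *
  have hnint := nint_sub_half_eq_floor hne
  refine ⟨?_, hnint⟩
  rw [hnint]
  have h2 := Int.floor_add_fract (approxMean θ n - 1 / 2)
  have hhalf := hfar'.trans_le habs
  rcases lt_abs.1 hfar' with h | h
  · have hfl : ⌊approxMean θ n⌋ = ⌊approxMean θ n - 1 / 2⌋ + 1 := by
      rw [Int.floor_eq_iff]; push_cast; constructor <;> linarith
    rw [hfl]
    exact hn₀ n hn0 _ (by push_cast; linarith) (by push_cast; linarith)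
  · have hfl : ⌊approxMean θ n⌋ = ⌊approxMean θ n - 1 / 2⌋ := by
      rw [Int.floor_eq_iff]; constructor <;> linarith
    rw [hfl]
    exact hn₀ n hn0 _ (by linarith) (by linarith)

/-! ### Integers with a prescribed approximate mean -/

/-- The real number at which `θ log x - θ ψ(θ)` takes the value `t`. -/
noncomputable def approxMeanInv (θ t : ℝ) : ℝ := Real.exp (t / θ + psi θ)

theorem approxMeanInv_pos (θ t : ℝ) : 0 < approxMeanInv θ t := Real.exp_pos _

theorem approxMean_eq {θ : ℝ} (hθ : 0 < θ) (t : ℝ) {n : ℕ} (hn : 0 < n) :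
    approxMean θ n = t + θ * Real.log (n / approxMeanInv θ t) := by
  have : (n : ℝ) ≠ 0 := by positivity
  rw [Real.log_div this (approxMeanInv_pos θ t).ne', approxMeanInv, Real.log_exp, approxMean]
  field_simp
  ring

theorem tendsto_approxMeanInv {θ : ℝ} (hθ : 0 < θ) (a : ℝ) :
    Tendsto (fun j : ℕ => approxMeanInv θ (j + a)) atTop atTop := by
  refine Real.tendsto_exp_atTop.comp (tendsto_atTop_add_const_right _ _ ?_)
  exact (tendsto_atTop_add_const_right _ _ tendsto_natCast_atTop_atTop).atTop_div_const hθ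

/-- Beyond the point `x` where the value is `j + α`, moving by `1 + L` raises `approxMean` by at
most `θ (1 + L) / x`, which is small for large `j`. -/
theorem exists_long_interval {θ : ℝ} (hθ : 0 < θ) {α β : ℝ} (hαβ : α < β) (n₀ L : ℕ) :
    ∃ N : ℕ, n₀ ≤ N ∧ ∃ j : ℤ, ∀ n ∈ Set.Ico N (N + L),
      j + α ≤ approxMean θ n ∧ approxMean θ n ≤ j + β := by
  obtain ⟨j, hj1, hj2⟩ := (((tendsto_approxMeanInv hθ α).eventually_ge_atTop (n₀ : ℝ)).and
    ((tendsto_approxMeanInv hθ α).eventually_ge_atTop (θ * (1 + L) / (β - α)))).exists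
  set x := approxMeanInv θ (j + α) with hx
  have hx0 : 0 < x := approxMeanInv_pos _ _
  refine ⟨⌈x⌉₊, ?_, j, fun n hn => ?_⟩
  · exact_mod_cast hj1.trans (Nat.le_ceil x)
  have h1 : x ≤ n := (Nat.le_ceil x).trans (by exact_mod_cast hn.1)
  have h2 : (n : ℝ) ≤ x + (1 + L) := by
    have := Nat.ceil_lt_add_one hx0.le
    have h3 : (n : ℝ) ≤ ⌈x⌉₊ + L := by exact_mod_cast hn.2.le
    linarith
  have hn0 : 0 < n := by
    have : (0 : ℝ) < n := by linarith
    exact_mod_cast this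
  rw [approxMean_eq hθ (j + α) hn0, ← hx]
  push_cast
  constructor
  · have : 0 ≤ Real.log (n / x) := Real.log_nonneg (by rwa [le_div_iff₀ hx0, one_mul])
    linarith [mul_nonneg hθ.le this]
  · have h3 := Real.log_le_sub_one_of_pos (show 0 < n / x by positivity)
    have h4 : n / x - 1 ≤ (1 + L) / x := by
      rw [div_sub_one hx0.ne']; gcongr; linarith
    have h5 : θ * ((1 + L) / x) ≤ β - α := by
      rw [div_le_iff₀ (by linarith)] at hj2
      rw [← mul_div_assoc, div_le_iff₀ hx0]
      linarith
    linarith [mul_le_mul_of_nonneg_left (h3.trans h4) hθ.le]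

/-- Take the last integer `n` before the real point where the value is `j`: the gap is at most `θ /
n`, eventually below `c / log n`. -/
theorem exists_near_below {θ : ℝ} (hθ : 0 < θ) {c : ℝ} (hc : 0 < c) (n₀ : ℕ) :
    ∃ n ≥ n₀, ∃ N : ℤ, approxMean θ n < N ∧ N - c / Real.log n ≤ approxMean θ n := by
  obtain ⟨n₁, hn₁⟩ := eventually_atTop.1 (eventually_div_le (a := θ) hc)
  obtain ⟨j, hj⟩ := ((tendsto_approxMeanInv hθ 0).eventually_ge_atTop
    ((n₀ : ℝ) + n₁ + 2)).exists
  rw [add_zero] at hj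
  set x := approxMeanInv θ j with hx
  have hx0 : 0 < x := approxMeanInv_pos _ _
  have c1 := Nat.ceil_lt_add_one hx0.le
  have c2 := Nat.le_ceil x
  have hcpos : 1 ≤ ⌈x⌉₊ := Nat.one_le_ceil_iff.2 hx0
  obtain ⟨n, hn⟩ := Nat.exists_eq_add_of_le' hcpos
  rw [hn] at c1 c2
  push_cast at c1 c2
  have hbig : n₀ + n₁ + 1 ≤ n := by
    have : (n₀ : ℝ) + n₁ + 1 ≤ n := by linarith
    exact_mod_cast this
  have hn0 : (0 : ℝ) < n := by exact_mod_cast (by omega : 0 < n)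
  refine ⟨n, by omega, j, ?_, ?_⟩
  all_goals rw [approxMean_eq hθ j (by omega), ← hx]; push_cast
  · have : Real.log (n / x) < 0 := Real.log_neg (by positivity) (by rw [div_lt_one hx0]; linarith)
    linarith [mul_neg_of_pos_of_neg hθ this]
  · have h1 := Real.one_sub_inv_le_log_of_pos (show 0 < n / x by positivity)
    have h2 : -(1 / n) ≤ 1 - ((n : ℝ) / x)⁻¹ := by
      rw [inv_div, one_sub_div hn0.ne', ← neg_div]
      gcongr
      linarith
    have h3 := hn₁ n (by omega)
    have h4 := mul_le_mul_of_nonneg_left (h2.trans h1) hθ.le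
    have h5 : θ / n = θ * (1 / n) := by ring
    linarith

/-! ### Asymptotic density -/

theorem card_le_of_diam_le (T : Finset ℕ) {d : ℝ} (hd : 0 ≤ d)
    (h : ∀ a ∈ T, ∀ b ∈ T, a ≤ b → (b : ℝ) - a ≤ d) : (T.card : ℝ) ≤ d + 1 := by
  rcases T.eq_empty_or_nonempty with rfl | hT
  · simp; linarith
  have hsub : T ⊆ Finset.Icc (T.min' hT) (T.max' hT) := fun x hx =>
    Finset.mem_Icc.2 ⟨T.min'_le x hx, T.le_max' x hx⟩
  have hle : T.min' hT ≤ T.max' hT := T.min'_le _ (T.max'_mem hT)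
  have h1 := h _ (T.min'_mem hT) _ (T.max'_mem hT) hle
  have h2 := Finset.card_le_card hsub
  rw [Nat.card_Icc] at h2
  have h3 : T.card + T.min' hT ≤ T.max' hT + 1 := by omega
  have h4 : (T.card : ℝ) + T.min' hT ≤ T.max' hT + 1 := by exact_mod_cast h3
  linarith

theorem hasAsymptoticDensity_one {A : Set ℕ}
    (h : ∀ ε : ℝ, 0 < ε → ∀ᶠ X : ℕ in atTop, ((Set.Icc 1 X \ A).ncard : ℝ) ≤ ε * X) :
    HasAsymptoticDensity A 1 := by
  refine Metric.tendsto_atTop'.2 fun ε hε => ?_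
  obtain ⟨X₀, hX₀⟩ := eventually_atTop.1 (h (ε / 2) (by linarith))
  refine ⟨X₀, fun X hX => ?_⟩
  have h1 := hX₀ X hX.le
  have h2 := Set.ncard_inter_add_ncard_sdiff_eq_ncard (Set.Icc 1 X) A (Set.finite_Icc 1 X)
  have h3 : (Set.Icc 1 X).ncard = X := by
    rw [← Finset.coe_Icc, Set.ncard_coe_finset, Nat.card_Icc]; omega
  rw [h3, Set.inter_comm] at h2
  have hX0 : (0 : ℝ) < X := by exact_mod_cast (by omega : 0 < X)
  have h4 : ((A ∩ Set.Icc 1 X).ncard : ℝ) + (Set.Icc 1 X \ A).ncard = X := by exact_mod_cast h2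
  have h5 : (0 : ℝ) ≤ (Set.Icc 1 X \ A).ncard := Nat.cast_nonneg _
  rw [Real.dist_eq, div_sub_one hX0.ne', abs_div, abs_of_pos hX0, div_lt_iff₀ hX0, abs_lt]
  have : 0 < ε * X := by positivity
  constructor <;> linarith

open scoped Classical in
/-- The number of `n ≤ X` with `θ log n - θ ψ(θ)` close to a given number. -/
theorem card_near_le {θ : ℝ} (hθ : 0 < θ) {δ : ℝ} (hδ : 0 ≤ δ) (X : ℕ) (t : ℝ) :
    (((Finset.Icc 1 X).filter fun n => |approxMean θ n - t| ≤ δ).card : ℝ) ≤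
      X * (Real.exp (2 * δ / θ) - 1) + 1 := by
  have he : 0 ≤ Real.exp (2 * δ / θ) - 1 := by
    linarith [Real.one_le_exp (show 0 ≤ 2 * δ / θ by positivity)]
  refine card_le_of_diam_le _ (by positivity) fun a ha b hb _ => ?_
  simp only [Finset.mem_filter, Finset.mem_Icc] at ha hb
  obtain ⟨⟨ha1, haX⟩, ha2⟩ := ha
  obtain ⟨⟨hb1, -⟩, hb2⟩ := hb
  have ha0 : (0 : ℝ) < a := by exact_mod_cast ha1
  have hb0 : (0 : ℝ) < b := by exact_mod_cast hb1
  have h1 : Real.log b ≤ Real.log a + 2 * δ / θ := by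
    have h3 := (abs_le.1 ha2).1
    have h4 := (abs_le.1 hb2).2
    rw [approxMean] at h3 h4
    have : Real.log b - Real.log a ≤ 2 * δ / θ := by
      rw [le_div_iff₀ hθ]; linarith
    linarith
  have h2 : (b : ℝ) ≤ a * Real.exp (2 * δ / θ) := by
    rw [← Real.exp_log ha0, ← Real.exp_add, ← Real.log_le_iff_le_exp hb0]
    exact h1
  have h3 : (a : ℝ) * (Real.exp (2 * δ / θ) - 1) ≤ X * (Real.exp (2 * δ / θ) - 1) := by
    gcongr
  linarith

open scoped Classical in
/-- A set containing all large `n` with `θ log n - θ ψ(θ)` away from the integers has density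
one. -/
theorem hasAsymptoticDensity_one_of_far {θ : ℝ} (hθ : 0 < θ) {A : Set ℕ}
    (hA : ∀ δ : ℝ, 0 < δ → ∀ᶠ n : ℕ in atTop,
      (∀ N : ℤ, δ < |approxMean θ n - N|) → n ∈ A) :
    HasAsymptoticDensity A 1 := by
  refine hasAsymptoticDensity_one fun ε hε => ?_
  -- Three contributions of at most `ε' X` arise: the `n ≤ ε' X`, the lengths of the windows, and
  -- the `+ 1` of each window.
  set ε' := ε / 4 with hε'
  have hε'0 : 0 < ε' := by positivity
  -- On `ε' X < n ≤ X` the value varies by at most `θ |log ε'|`, so with a margin of 1 at each end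
  -- at most `L` integers are relevant.
  set L := θ * |Real.log ε'| + 3 with hL
  have hL0 : 0 < L := by positivity
  obtain ⟨δ, hδ0, hδ1, hδ⟩ : ∃ δ : ℝ, 0 < δ ∧ δ ≤ 1 ∧ L * (Real.exp (2 * δ / θ) - 1) < ε' := by
    have hcont : Continuous fun δ : ℝ => L * (Real.exp (2 * δ / θ) - 1) := by fun_prop
    have ht := hcont.tendsto 0
    simp only [mul_zero, zero_div, Real.exp_zero, sub_self] at ht
    have hev := (ht.mono_left (nhdsWithin_le_nhds (s := Set.Ioi 0))).eventually_lt_const hε'0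
    obtain ⟨δ, h1, h2, h3⟩ := (hev.and (Ioc_mem_nhdsGT (zero_lt_one' ℝ))).exists
    exact ⟨δ, h2, h3, h1⟩
  obtain ⟨n₀, hn₀⟩ := eventually_atTop.1 (hA δ hδ0)
  filter_upwards [(tendsto_natCast_atTop_atTop (R := ℝ)).eventually_ge_atTop (n₀ / ε'),
    (tendsto_natCast_atTop_atTop (R := ℝ)).eventually_ge_atTop (L / ε'),
    eventually_ge_atTop 1] with X hX1 hX2 hX3
  rw [div_le_iff₀ hε'0] at hX1 hX2
  have hX0 : (0 : ℝ) < X := by exact_mod_cast hX3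
  set lo := approxMean θ X - θ * |Real.log ε'| - 1 with hlo
  set hi := approxMean θ X + 1 with hhi
  set S := Finset.Icc ⌈lo⌉ ⌊hi⌋ with hS
  have hsub : Set.Icc 1 X \ A ⊆ ((Finset.Icc 1 ⌊ε' * X⌋₊ ∪
      S.biUnion fun N => (Finset.Icc 1 X).filter fun n => |approxMean θ n - N| ≤ δ : Finset ℕ) :
        Set ℕ) := by
    rintro n ⟨⟨hn1, hnX⟩, hnA⟩
    have hn0 : (0 : ℝ) < n := by exact_mod_cast hn1
    simp only [Finset.coe_union, Set.mem_union, Finset.mem_coe, Finset.mem_Icc,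
      Finset.mem_biUnion, Finset.mem_filter]
    by_cases hsmall : (n : ℝ) ≤ ε' * X
    · exact Or.inl ⟨hn1, Nat.le_floor hsmall⟩
    right
    push Not at hsmall
    have hnn₀ : n₀ ≤ n := by
      have : (n₀ : ℝ) ≤ n := by linarith
      exact_mod_cast this
    have hbad := mt (hn₀ n hnn₀) hnA
    push Not at hbad
    obtain ⟨N, hN⟩ := hbad
    refine ⟨N, ?_, ⟨hn1, hnX⟩, hN⟩
    obtain ⟨h1, h2⟩ := abs_le.1 hN
    have h3 : Real.log n ≤ Real.log X := Real.log_le_log hn0 (by exact_mod_cast hnX)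
    have h4 : Real.log ε' + Real.log X ≤ Real.log n := by
      rw [← Real.log_mul hε'0.ne' hX0.ne']
      exact Real.log_le_log (by positivity) hsmall.le
    have h5 := mul_le_mul_of_nonneg_left h3 hθ.le
    have h6 := mul_le_mul_of_nonneg_left h4 hθ.le
    have h7 := mul_le_mul_of_nonneg_left (neg_abs_le (Real.log ε')) hθ.le
    have e1 : approxMean θ n = θ * Real.log n - θ * psi θ := rfl
    have e2 : approxMean θ X = θ * Real.log X - θ * psi θ := rfl
    rw [hS, Finset.mem_Icc]
    exact ⟨Int.ceil_le.2 (by linarith), Int.le_floor.2 (by linarith)⟩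
  have hScard : (S.card : ℝ) ≤ L := by
    rw [hS, Int.card_Icc]
    have h1 : (⌊hi⌋ : ℝ) ≤ hi := Int.floor_le hi
    have h2 : lo ≤ ⌈lo⌉ := Int.le_ceil lo
    rcases le_or_gt 0 (⌊hi⌋ + 1 - ⌈lo⌉) with h | h
    · have h3 : (((⌊hi⌋ + 1 - ⌈lo⌉).toNat : ℤ) : ℝ) = ((⌊hi⌋ + 1 - ⌈lo⌉ : ℤ) : ℝ) := by
        rw [Int.toNat_of_nonneg h]
      rw [Int.cast_natCast] at h3
      rw [h3]
      push_cast
      linarith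
    · rw [Int.toNat_of_nonpos h.le]
      simpa using hL0.le
  have he : 0 ≤ Real.exp (2 * δ / θ) - 1 := by
    linarith [Real.one_le_exp (show 0 ≤ 2 * δ / θ by positivity)]
  have hcard := Set.ncard_le_ncard hsub (Finset.finite_toSet _)
  rw [Set.ncard_coe_finset] at hcard
  have h1 : ((Set.Icc 1 X \ A).ncard : ℝ) ≤ ⌊ε' * X⌋₊ +
      ∑ N ∈ S, (((Finset.Icc 1 X).filter fun n => |approxMean θ n - N| ≤ δ).card : ℝ) := by
    have h := hcard.trans ((Finset.card_union_le _ _).trans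
      (Nat.add_le_add_left Finset.card_biUnion_le _))
    rw [Nat.card_Icc, Nat.add_sub_cancel] at h
    exact_mod_cast h
  have h2 : (⌊ε' * X⌋₊ : ℝ) ≤ ε' * X := Nat.floor_le (by positivity)
  have h3 : ∑ N ∈ S, (((Finset.Icc 1 X).filter fun n => |approxMean θ n - N| ≤ δ).card : ℝ) ≤
      L * (X * (Real.exp (2 * δ / θ) - 1) + 1) := by
    refine (Finset.sum_le_card_nsmul S
      (fun N : ℤ => (((Finset.Icc 1 X).filter fun n => |approxMean θ n - N| ≤ δ).card : ℝ)) _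
      fun N _ => card_near_le hθ hδ0.le X N).trans ?_
    rw [nsmul_eq_mul]
    gcongr
  have h4 := mul_le_mul_of_nonneg_right hδ.le hX0.le
  have h5 : ε = 4 * ε' := by rw [hε']; ring
  rw [h5]
  have : 0 < ε' * X := by positivity
  linarith

/-! ### Long intervals, density one and infinitely many exceptions -/

/-- For every fixed `δ`, the mode is eventually the integer part of `θ log n - θ ψ(θ)`, unless
the latter is within `δ` of an integer. -/
theorem eventually_mode_eq_floor {θ : ℝ} (hθ : 0 < θ) {δ : ℝ} (hδ : 0 < δ) :
    ∀ᶠ n : ℕ in atTop, ∀ N : ℤ, N + δ ≤ approxMean θ n → approxMean θ n ≤ N + 1 - δ →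
      (mode θ n : ℤ) = N := by
  obtain ⟨C, -, hev⟩ := mode_eq_of_far hθ
  have hsmall : ∀ᶠ n : ℕ in atTop, C / Real.log n < δ :=
    (tendsto_const_nhds.div_atTop tendsto_log_natCast).eventually_lt_const hδ
  filter_upwards [hev, hsmall] with n h1 h2 N h3 h4
  exact h1 N (by linarith) (by linarith)

/-- The general `f` covers the floor and `nint` at once, since they agree whenever `approxMean` is
not an integer. -/
theorem hasAsymptoticDensity_mode_eq {θ : ℝ} (hθ : 0 < θ) (f : ℕ → ℤ)
    (hf : ∀ n, Int.fract (approxMean θ n) ≠ 0 → f n = ⌊approxMean θ n⌋) :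
    HasAsymptoticDensity {n : ℕ | 1 ≤ n ∧ (mode θ n : ℤ) = f n} 1 := by
  refine hasAsymptoticDensity_one_of_far hθ fun δ hδ => ?_
  filter_upwards [eventually_mode_eq_floor hθ hδ, eventually_ge_atTop 1] with n h1 h2 h3
  refine ⟨h2, ?_⟩
  have h4 := Int.floor_add_fract (approxMean θ n)
  have h5 := Int.fract_nonneg (approxMean θ n)
  have h6 := Int.fract_lt_one (approxMean θ n)
  have a1 := h3 ⌊approxMean θ n⌋
  have a2 := h3 (⌊approxMean θ n⌋ + 1)
  push_cast at a2
  rw [abs_of_nonneg (by linarith)] at a1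
  rw [abs_of_nonpos (by linarith)] at a2
  rw [hf n (by intro h; linarith)]
  exact h1 _ (by linarith) (by linarith)

/-- Just below an integer `N`, the floor is `N - 1`, the very value that the mode avoids. -/
theorem infinite_mode_ne {θ : ℝ} (hθ : 0 < θ) (f : ℕ → ℤ)
    (hf : ∀ n, Int.fract (approxMean θ n) ≠ 0 → f n = ⌊approxMean θ n⌋) :
    {n : ℕ | 1 ≤ n ∧ (mode θ n : ℤ) ≠ f n}.Infinite := by
  obtain ⟨c, hc, hev⟩ := mode_ne_of_near hθ
  have hsmall : ∀ᶠ n : ℕ in atTop, c / Real.log n < 1 :=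
    (tendsto_const_nhds.div_atTop tendsto_log_natCast).eventually_lt_const one_pos
  obtain ⟨n₀, hn₀⟩ := eventually_atTop.1 (hev.and hsmall)
  refine Set.infinite_of_forall_exists_gt fun a => ?_
  obtain ⟨n, hn, N, hN1, hN2⟩ := exists_near_below hθ hc (n₀ + a + 1)
  obtain ⟨h1, h2⟩ := hn₀ n (by omega)
  have hfl : ⌊approxMean θ n⌋ = N - 1 := by
    rw [Int.floor_eq_iff]; push_cast; constructor <;> linarith
  refine ⟨n, ⟨by omega, ?_⟩, by omega⟩
  rw [hf n, hfl]
  · exact h1 N hN1 hN2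
  · intro h
    have h3 := Int.floor_add_fract (approxMean θ n)
    rw [hfl, h] at h3
    push_cast at h3
    linarith

theorem nint_modeApprox_eq (θ : ℝ) (n : ℕ) (h : Int.fract (approxMean θ n) ≠ 0) :
    nint (modeApprox θ n) = ⌊approxMean θ n⌋ := by
  rw [modeApprox_eq]
  refine nint_sub_half_eq_floor fun h' => h ?_
  have h2 := Int.floor_add_fract (approxMean θ n - 1 / 2)
  rw [Int.fract_eq_iff]
  refine ⟨le_rfl, one_pos, ⌊approxMean θ n - 1 / 2⌋ + 1, ?_⟩
  push_cast
  linarith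

theorem exists_interval_mode_eq_ceil {θ : ℝ} (hθ : 0 < θ) (L : ℕ) :
    ∃ N : ℕ, 1 ≤ N ∧ ∀ n ∈ Set.Ico N (N + L), (mode θ n : ℤ) = ⌈modeApprox θ n⌉ := by
  obtain ⟨n₀, hn₀⟩ := eventually_atTop.1
    (eventually_mode_eq_floor hθ (show (0 : ℝ) < 1 / 5 by norm_num))
  -- With fractional part below `1/2`, subtracting `1/2` crosses `j`, and the ceiling returns to it.
  obtain ⟨N, hN, j, hj⟩ := exists_long_interval hθ (show (1 / 5 : ℝ) < 2 / 5 by norm_num)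
    (n₀ + 1) L
  refine ⟨N, by omega, fun n hn => ?_⟩
  obtain ⟨h1, h2⟩ := hj n hn
  rw [hn₀ n (by have := hn.1; omega) j (by linarith) (by linarith), modeApprox_eq]
  symm
  rw [Int.ceil_eq_iff]
  constructor <;> linarith

theorem exists_interval_mode_eq_floor {θ : ℝ} (hθ : 0 < θ) (L : ℕ) :
    ∃ N : ℕ, 1 ≤ N ∧ ∀ n ∈ Set.Ico N (N + L), (mode θ n : ℤ) = ⌊modeApprox θ n⌋ := by
  obtain ⟨n₀, hn₀⟩ := eventually_atTop.1
    (eventually_mode_eq_floor hθ (show (0 : ℝ) < 1 / 5 by norm_num))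
  -- With fractional part above `1/2`, subtracting `1/2` stays above `j`, so the floor is unchanged.
  obtain ⟨N, hN, j, hj⟩ := exists_long_interval hθ (show (3 / 5 : ℝ) < 4 / 5 by norm_num)
    (n₀ + 1) L
  refine ⟨N, by omega, fun n hn => ?_⟩
  obtain ⟨h1, h2⟩ := hj n hn
  rw [hn₀ n (by have := hn.1; omega) j (by linarith) (by linarith), modeApprox_eq]
  symm
  rw [Int.floor_eq_iff]
  constructor <;> linarith

end Ewens

theorem theorem1p6 (θ : ℝ) (hθ : 0 < θ) :
    -- (i)
    (∃ C₀ : ℝ, 0 < C₀ ∧ ∀ n : ℕ, 2 ≤ n →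
      |Int.fract (Ewens.modeApprox θ n) - 1 / 2| > C₀ / Real.log n →
        (Ewens.mode θ n : ℤ) = Ewens.nint (Ewens.modeApprox θ n) ∧
        Ewens.nint (Ewens.modeApprox θ n) =
          ⌊θ * Real.log n - θ * deriv Real.Gamma θ / Real.Gamma θ⌋) ∧
    -- (ii)
    ((∀ L : ℕ, ∃ N : ℕ, 1 ≤ N ∧ ∀ n ∈ Set.Ico N (N + L),
        (Ewens.mode θ n : ℤ) = ⌈Ewens.modeApprox θ n⌉) ∧
      (∀ L : ℕ, ∃ N : ℕ, 1 ≤ N ∧ ∀ n ∈ Set.Ico N (N + L),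
        (Ewens.mode θ n : ℤ) = ⌊Ewens.modeApprox θ n⌋)) ∧
    -- (iii)
    (Ewens.HasAsymptoticDensity
        {n : ℕ | 1 ≤ n ∧ (Ewens.mode θ n : ℤ) = Ewens.nint (Ewens.modeApprox θ n)} 1 ∧
      Ewens.HasAsymptoticDensity
        {n : ℕ | 1 ≤ n ∧ (Ewens.mode θ n : ℤ) =
          ⌊θ * Real.log n - θ * deriv Real.Gamma θ / Real.Gamma θ⌋} 1) ∧
    -- (iv)
    ({n : ℕ | 1 ≤ n ∧ (Ewens.mode θ n : ℤ) ≠ Ewens.nint (Ewens.modeApprox θ n)}.Infinite ∧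
      {n : ℕ | 1 ≤ n ∧ (Ewens.mode θ n : ℤ) ≠
          ⌊θ * Real.log n - θ * deriv Real.Gamma θ / Real.Gamma θ⌋}.Infinite) := by
  simp only [Ewens.floor_approxMean_eq]
  exact ⟨Ewens.mode_eq_nint_of_far hθ,
    ⟨Ewens.exists_interval_mode_eq_ceil hθ, Ewens.exists_interval_mode_eq_floor hθ⟩,
    ⟨Ewens.hasAsymptoticDensity_mode_eq hθ _ (Ewens.nint_modeApprox_eq θ),
      Ewens.hasAsymptoticDensity_mode_eq hθ _ fun _ _ => rfl⟩,
    Ewens.infinite_mode_ne hθ _ (Ewens.nint_modeApprox_eq θ),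
    Ewens.infinite_mode_ne hθ _ fun _ _ => rfl⟩
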